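/- Let $k$ be a field and let $n \ge 5$ be an integer. Let $\mathfrak{S}_{(n,4)} = \langle n^2+2n,\ n^2+2n+1,\ n^2+3n+1,\ n^2+3n+2\rangle \subset \mathbb{N}$, let $R = k[[\mathfrak{S}_{(n,4)}]]$ be its semigroup ring (the ring of power series in $k[[t]]$ supported on $\mathfrak{S}_{(n,4)}$), a local ring with maximal ideal $\mathfrak{m}$, and let $I = (t^{n^2+2n}) \subset R$. Let $G = \bigoplus_{d\ge 0} \mathfrak{m}^d/\mathfrak{m}^{d+1}$ be the tangent cone and $F(I) = \bigoplus_{d\ge 0} I^d/\mathfrak{m}I^d$ the fiber cone of $I$, and regard $G$ as a graded $F(I)$-module through the canonical ring homomorphism $F(I)\to G$. Then: 1. $G$ is a free $F(I)$-module, and there is an isomorphism of graded $F(I)$-modules $$G \;\cong\; \bigoplus_{j=0}^{n-1} F(I)(-j)^{2j+1}\ \oplus\ F(I)(-n)^{2n}.$$ 2. $G$ is a Cohen–Macaulay ring. 3. All the spaces $\mathfrak{m}^d/\mathfrak{m}^{d+1}$ are finite-dimensional over $k$, and the Hilbert series of $G$ is $$\sum_{d\ge 0}\dim_k\left(\mathfrak{m}^d/\mathfrak{m}^{d+1}\right)x^d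 \;=\; \frac{\sum_{j=0}^{n-1}(2j+1)x^j + 2n\,x^n}{1-x}.$$ -/

import Mathlib

open scoped PowerSeries Polynomial

noncomputable section

section FiberCone

universe u

variable {R : Type u} [CommRing R]

/-- The blow-up ring `⨁ Iᵈ / J Iᵈ`, realised as the Rees algebra of `I` modulo the extension
of `J`. For `(R, J)` local this is the fiber cone `F(I)` of `I`, and for `I = J` it is the
associated graded ring of `J`. -/
abbrev FiberCone (J I : Ideal R) : Type u :=
  reesAlgebra I ⧸ J.map (algebraMap R (reesAlgebra I))

/-- The canonical map from `Iᵈ` to the fiber cone, `r ↦ class of r Tᵈ`. -/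
def FiberCone.ofDegree (J I : Ideal R) (d : ℕ) : ↥(I ^ d) →ₗ[R] FiberCone J I :=
  (Ideal.Quotient.mkₐ R (J.map (algebraMap R (reesAlgebra I)))).toLinearMap ∘ₗ
    { toFun := fun r => ⟨Polynomial.monomial d (r : R), reesAlgebra.monomial_mem.2 r.2⟩
      map_add' := fun x y => by ext1; simp
      map_smul' := fun c x => by ext1; simp [Polynomial.smul_monomial] }

/-- The homogeneous component of degree `d` of the fiber cone. -/
def FiberCone.component (J I : Ideal R) (d : ℕ) : Submodule R (FiberCone J I) :=
  LinearMap.range (FiberCone.ofDegree J I d)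

theorem FiberCone.mem_map_iff (J I : Ideal R) (f : reesAlgebra I) :
    f ∈ J.map (algebraMap R (reesAlgebra I)) ↔ ∀ i, (f : R[X]).coeff i ∈ J * I ^ i := by
  constructor
  · intro hf
    refine Submodule.span_induction (p := fun (g : reesAlgebra I) _ =>
      ∀ i, (g : R[X]).coeff i ∈ J * I ^ i) ?_ ?_ ?_ ?_ hf
    · rintro _ ⟨r, hr, rfl⟩ i
      rw [show ((algebraMap R (reesAlgebra I) r : reesAlgebra I) : R[X]) = Polynomial.C r from rfl,
        Polynomial.coeff_C]
      split_ifs with h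
      · subst h; simpa using hr
      · exact Ideal.zero_mem _
    · intro i; simp
    · intro x y _ _ hx hy i
      simpa using Ideal.add_mem _ (hx i) (hy i)
    · intro a x _ hx i
      simp only [smul_eq_mul, MulMemClass.coe_mul, Polynomial.coeff_mul]
      refine Ideal.sum_mem _ fun p hp => ?_
      rw [← Finset.HasAntidiagonal.mem_antidiagonal.mp hp, pow_add, mul_left_comm]
      exact Ideal.mul_mem_mul (a.2 p.1) (hx p.2)
  · intro hf
    have key : ∀ i (r : R), r ∈ J * I ^ i → ∃ h : Polynomial.monomial i r ∈ reesAlgebra I,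
        (⟨Polynomial.monomial i r, h⟩ : reesAlgebra I) ∈
          J.map (algebraMap R (reesAlgebra I)) := by
      intro i r hr
      refine Submodule.mul_induction_on hr ?_ ?_
      · intro a ha b hb
        refine ⟨reesAlgebra.monomial_mem.2 (Ideal.mul_mem_left _ _ hb), ?_⟩
        convert Ideal.mul_mem_right
          (⟨Polynomial.monomial i b, reesAlgebra.monomial_mem.2 hb⟩ : reesAlgebra I) _
          (Ideal.mem_map_of_mem (algebraMap R (reesAlgebra I)) ha) using 1
        ext1
        change _ = Polynomial.C a * Polynomial.monomial i b
        rw [Polynomial.C_mul_monomial]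
      · rintro x y ⟨hx, hx'⟩ ⟨hy, hy'⟩
        refine ⟨by simpa using Subalgebra.add_mem _ hx hy, ?_⟩
        convert Ideal.add_mem _ hx' hy' using 1
        ext1
        simp
    have hsum : f = ∑ i ∈ (f : R[X]).support,
        (⟨Polynomial.monomial i ((f : R[X]).coeff i),
          reesAlgebra.monomial_mem.2 (f.2 i)⟩ : reesAlgebra I) := by
      ext1
      rw [AddSubmonoidClass.coe_finsetSum]
      exact (f : R[X]).as_sum_support
    rw [hsum]
    exact Ideal.sum_mem _ fun i _ => (key i _ (hf i)).2

/-- The degree `d` component of the fiber cone is `Iᵈ / J Iᵈ`. -/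
theorem FiberCone.ofDegree_eq_zero_iff (J I : Ideal R) (d : ℕ) (x : ↥(I ^ d)) :
    FiberCone.ofDegree J I d x = 0 ↔ (x : R) ∈ J * I ^ d := by
  change Ideal.Quotient.mk _ _ = 0 ↔ _
  rw [Ideal.Quotient.eq_zero_iff_mem, FiberCone.mem_map_iff]
  constructor
  · intro h; simpa using h d
  · intro h i
    change (Polynomial.monomial d (x : R)).coeff i ∈ _
    rw [Polynomial.coeff_monomial]
    split_ifs with hi
    · subst hi; exact h
    · exact Ideal.zero_mem _

/-- The ring homomorphism `F(I) → F(I')` induced by an inclusion `I ≤ I'`. -/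
def FiberCone.map (J : Ideal R) {I I' : Ideal R} (h : I ≤ I') :
    FiberCone J I →+* FiberCone J I' :=
  Ideal.quotientMap _
    (Subalgebra.inclusion (S := reesAlgebra I) (T := reesAlgebra I')
      fun _ hf i => Ideal.pow_right_mono h i (hf i) : reesAlgebra I →+* reesAlgebra I')
    (by
      rw [Ideal.map_le_iff_le_comap]
      intro r hr
      exact Ideal.mem_map_of_mem (algebraMap R (reesAlgebra I')) hr)

/-- The homogeneous component of degree `d` of the graded free module
`⨁ⱼ F(I)(-deg j)` over the fiber cone `F(I)`. -/
def FiberCone.shiftedComponent (J I : Ideal R) {ι : Type*} (deg : ι → ℕ) (d : ℕ) :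
    Set (ι →₀ FiberCone J I) :=
  {v | ∀ j, (deg j ≤ d → v j ∈ FiberCone.component J I (d - deg j)) ∧ (d < deg j → v j = 0)}

/-- The tangent cone of a local ring: the associated graded ring `⨁ 𝔪ᵈ / 𝔪ᵈ⁺¹`. -/
abbrev TangentCone (R : Type u) [CommRing R] [IsLocalRing R] : Type u :=
  FiberCone (IsLocalRing.maximalIdeal R) (IsLocalRing.maximalIdeal R)

/-- The homogeneous component `𝔪ᵈ / 𝔪ᵈ⁺¹` of the tangent cone. -/
abbrev TangentCone.component (R : Type u) [CommRing R] [IsLocalRing R] (d : ℕ) :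
    Submodule R (TangentCone R) :=
  FiberCone.component (IsLocalRing.maximalIdeal R) (IsLocalRing.maximalIdeal R) d

/-- The Hilbert series `∑ dim_k (𝔪ᵈ / 𝔪ᵈ⁺¹) xᵈ` of the tangent cone of a local `k`-algebra. -/
def TangentCone.hilbertSeries (k : Type*) [Field k] (R : Type u) [CommRing R] [IsLocalRing R]
    [Algebra k R] : ℚ⟦X⟧ :=
  PowerSeries.mk fun d => (Module.finrank k (TangentCone.component R d) : ℚ)

end FiberCone

section CohenMacaulay

/-- A local ring with a regular sequence in its maximal ideal of length its Krull dimension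
(for Noetherian rings: depth equals dimension). -/
def IsCohenMacaulayLocal (A : Type*) [CommRing A] [IsLocalRing A] : Prop :=
  ∃ rs : List A, (∀ r ∈ rs, r ∈ IsLocalRing.maximalIdeal A) ∧
    RingTheory.Sequence.IsRegular A rs ∧ (rs.length : WithBot ℕ∞) = ringKrullDim A

/-- A Noetherian ring all of whose localizations at maximal ideals are Cohen-Macaulay. -/
def IsCohenMacaulay (A : Type*) [CommRing A] : Prop :=
  IsNoetherianRing A ∧
    ∀ (P : Ideal A) [P.IsMaximal], IsCohenMacaulayLocal (Localization.AtPrime P)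

end CohenMacaulay

section SemigroupRing

/-- The numerical semigroup ring `k⟦S⟧`: the power series in `t` supported on `S`. -/
def semigroupRing (k : Type*) [Field k] (S : AddSubmonoid ℕ) : Subalgebra k k⟦X⟧ where
  carrier := {f | ∀ i, PowerSeries.coeff i f ≠ 0 → i ∈ S}
  mul_mem' {f g} hf hg i hi := by
    rw [PowerSeries.coeff_mul] at hi
    obtain ⟨p, hp, hne⟩ := Finset.exists_ne_zero_of_sum_ne_zero hi
    rw [← Finset.HasAntidiagonal.mem_antidiagonal.mp hp]
    exact S.add_mem (hf _ (left_ne_zero_of_mul hne)) (hg _ (right_ne_zero_of_mul hne))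
  add_mem' {f g} hf hg i hi := by
    by_cases h : PowerSeries.coeff i f = 0
    · refine hg i fun h' => hi ?_
      rw [map_add, h, h', add_zero]
    · exact hf i h
  algebraMap_mem' r i hi := by
    rw [PowerSeries.algebraMap_apply, PowerSeries.coeff_C] at hi
    split_ifs at hi with h
    · subst h; exact S.zero_mem
    · exact absurd rfl hi

theorem semigroupRing.isUnit_iff {k : Type*} [Field k] {S : AddSubmonoid ℕ}
    (f : semigroupRing k S) :
    IsUnit f ↔ PowerSeries.constantCoeff (f : k⟦X⟧) ≠ 0 := by
  constructor
  · intro h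
    exact ((h.map (semigroupRing k S).val).map (PowerSeries.constantCoeff (R := k))).ne_zero
  · intro h
    have hinv : ((f : k⟦X⟧)⁻¹) ∈ semigroupRing k S := by
      intro i
      induction i using Nat.strong_induction_on with
      | _ i ih =>
        intro hi
        rw [PowerSeries.coeff_inv] at hi
        split_ifs at hi with h0
        · subst h0; exact S.zero_mem
        · obtain ⟨p, hp, hne⟩ := Finset.exists_ne_zero_of_sum_ne_zero (right_ne_zero_of_mul hi)
          split_ifs at hne with hlt
          · rw [← Finset.HasAntidiagonal.mem_antidiagonal.mp hp]
            exact S.add_mem (f.2 _ (left_ne_zero_of_mul hne))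
              (ih _ hlt (right_ne_zero_of_mul hne))
          · exact absurd rfl hne
    refine IsUnit.of_mul_eq_one (⟨_, hinv⟩ : semigroupRing k S) ?_
    ext1
    exact PowerSeries.mul_inv_cancel _ h

instance semigroupRing.isLocalRing (k : Type*) [Field k] (S : AddSubmonoid ℕ) :
    IsLocalRing (semigroupRing k S) := by
  refine IsLocalRing.of_nonunits_add fun a b ha hb => ?_
  rw [mem_nonunits_iff, semigroupRing.isUnit_iff, not_not] at *
  simp [ha, hb]

/-- The monomial `tᵃ` of `k⟦S⟧`, for `a ∈ S`. -/
def semigroupRing.monomial (k : Type*) [Field k] {S : AddSubmonoid ℕ} (a : S) :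
    semigroupRing k S :=
  ⟨PowerSeries.X ^ (a : ℕ), fun i hi => by
    rw [PowerSeries.coeff_X_pow] at hi
    split_ifs at hi with h
    · exact h ▸ a.2
    · exact absurd rfl hi⟩

theorem semigroupRing.span_monomial_le (k : Type*) [Field k] {S : AddSubmonoid ℕ} (a : S)
    (ha : (a : ℕ) ≠ 0) :
    Ideal.span {semigroupRing.monomial k a} ≤ IsLocalRing.maximalIdeal (semigroupRing k S) := by
  rw [Ideal.span_singleton_le_iff_mem, IsLocalRing.mem_maximalIdeal, mem_nonunits_iff,
    semigroupRing.isUnit_iff, not_not]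
  simp [semigroupRing.monomial, ha]

end SemigroupRing

section UnboundedClass

/-- The numerical semigroup `⟨n²+2n, n²+2n+1, n²+3n+1, n²+3n+2⟩`. -/
def unboundedSemigroup (n : ℕ) : AddSubmonoid ℕ :=
  AddSubmonoid.closure {n ^ 2 + 2 * n, n ^ 2 + 2 * n + 1, n ^ 2 + 3 * n + 1, n ^ 2 + 3 * n + 2}

/-- The generator `n²+2n`. -/
def unboundedSemigroup.mult (n : ℕ) : unboundedSemigroup n :=
  ⟨n ^ 2 + 2 * n, AddSubmonoid.subset_closure (by simp)⟩

/-- The numerical semigroup ring of `⟨n²+2n, n²+2n+1, n²+3n+1, n²+3n+2⟩`. -/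
abbrev unboundedRing (k : Type*) [Field k] (n : ℕ) : Type _ :=
  semigroupRing k (unboundedSemigroup n)

/-- The ideal `⟨t^(n²+2n)⟩` of `k⟦S⟧`. -/
def unboundedIdeal (k : Type*) [Field k] (n : ℕ) :
    Ideal (unboundedRing k n) :=
  Ideal.span {semigroupRing.monomial k (unboundedSemigroup.mult n)}

theorem unboundedIdeal_le (k : Type*) [Field k] {n : ℕ} (hn : 5 ≤ n) :
    unboundedIdeal k n ≤ IsLocalRing.maximalIdeal (unboundedRing k n) :=
  semigroupRing.span_monomial_le k _ (by
    change n ^ 2 + 2 * n ≠ 0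
    positivity)

/-- The fiber cone `F(I)` of `I = ⟨t^(n²+2n)⟩`. -/
abbrev unboundedFiberCone (k : Type*) [Field k] (n : ℕ) : Type _ :=
  FiberCone (IsLocalRing.maximalIdeal (unboundedRing k n)) (unboundedIdeal k n)

/-- The canonical ring homomorphism from the fiber cone to the tangent cone. -/
def unboundedFiberCone.toTangentCone (k : Type*) [Field k] {n : ℕ} (hn : 5 ≤ n) :
    unboundedFiberCone k n →+* TangentCone (unboundedRing k n) :=
  FiberCone.map _ (unboundedIdeal_le k hn)

/-- Indices of the free generators: `2j+1` of them in each degree `j < n`, and `2n` of them in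
degree `n`. -/
abbrev unboundedIndex (n : ℕ) : Type :=
  Σ j : Fin (n + 1), Fin (if (j : ℕ) < n then 2 * (j : ℕ) + 1 else 2 * n)

end UnboundedClass

end

/-! Put `m = n² + 2n = (n+1)² - 1`. The generators are `m + e + (n+1)e'` with `e, e' ∈ {0,1}`, so a
sum of `q` of them is `qm + a + (n+1)b` with `a, b ≤ q`, and every such value occurs. Hence a
residue `a + (n+1)b < m`, written in base `n+1`, occurs in the semigroup exactly from quotient `max
a b` on.

One generator can be peeled off any element of quotient `d+1` or more, leaving quotient at least
`d`. So `𝔪^d` consists of the series of order at least `dm` (`mem_maximalIdeal_pow_iff`), and the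
tangent cone has as `k`-basis the monomials `t^s`, placed in degree `⌊s/m⌋`.

The fiber cone is `k[T]`, with `T` the class of `t^m`. Multiplication by `T` fixes the residue and
raises the degree by one (`coeff_toTangentCone_mul_monomial`). Each residue thus contributes one
free generator, of degree `max a b`. There are `2j+1` digit pairs with maximum `j`; for `j = n` the
pair `(n,n)` represents `m` itself and is dropped, which leaves `2n`. Graded freeness and the
Hilbert series follow, and a finite free algebra over `k[T]` is Cohen–Macaulay. -/

/-! ### Cohen–Macaulayness of finite torsion-free algebras over a principal ideal domain. -/

theorem isCohenMacaulay_of_finite_of_isTorsionFree (A G : Type*) [CommRing A] [IsDomain A]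
    [IsPrincipalIdealRing A] (hA : ¬ IsField A) [CommRing G] [Algebra A G] [Module.Finite A G]
    [Module.IsTorsionFree A G] : IsCohenMacaulay G := by
  have : IsNoetherianRing G := IsNoetherianRing.of_finite A G
  refine ⟨this, fun P hP => ?_⟩
  have hmax : (P.comap (algebraMap A G)).IsMaximal :=
    Ideal.isMaximal_comap_of_isIntegral_of_isMaximal P
  obtain ⟨f, hfP, hf0⟩ := Submodule.exists_mem_ne_zero_of_ne_bot
    (Ring.ne_bot_of_isMaximal_of_not_isField hmax hA)
  have hreg : algebraMap A G f ∈ nonZeroDivisors G := by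
    rw [mem_nonZeroDivisors_iff_right]
    intro x hx
    rw [mul_comm, ← Algebra.smul_def] at hx
    exact (smul_eq_zero.mp hx).resolve_left hf0
  set g := algebraMap G (Localization.AtPrime P) (algebraMap A G f) with hg
  have hgreg : g ∈ nonZeroDivisors (Localization.AtPrime P) :=
    IsLocalization.map_nonZeroDivisors_le P.primeCompl _ (Submonoid.mem_map_of_mem _ hreg)
  have hgmem : g ∈ IsLocalRing.maximalIdeal (Localization.AtPrime P) :=
    (IsLocalization.AtPrime.to_map_mem_maximal_iff _ P _).mpr hfP
  have hmem : ∀ r ∈ [g], r ∈ IsLocalRing.maximalIdeal (Localization.AtPrime P) := by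
    simpa using hgmem
  -- Krull's principal ideal theorem: `P` is minimal over `f`, because a prime containing `f`
  -- contracts to a nonzero, hence maximal, ideal of `A` and so is itself maximal by integrality.
  have hle : ringKrullDim (Localization.AtPrime P) ≤ 1 := by
    rw [IsLocalization.AtPrime.ringKrullDim_eq_height P]
    refine WithBot.coe_le_one.mpr
      (Ideal.height_le_one_of_isPrincipal_of_mem_minimalPrimes
        (Ideal.span {algebraMap A G f}) P ⟨⟨hP.isPrime, ?_⟩, ?_⟩)
    · rwa [Ideal.span_singleton_le_iff_mem]
    · rintro Q ⟨hQ, hfQ⟩ hQP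
      rw [Ideal.span_singleton_le_iff_mem] at hfQ
      have hne : Q.comap (algebraMap A G) ≠ ⊥ := fun h =>
        hf0 (by simpa [h] using (show f ∈ Q.comap (algebraMap A G) from hfQ))
      have hQmax : (Q.comap (algebraMap A G)).IsMaximal :=
        IsPrime.to_maximal_ideal hne
      have := Ideal.isMaximal_of_isIntegral_of_isMaximal_comap Q hQmax
      exact (this.eq_of_le hP.ne_top hQP).ge
  have hge : 1 ≤ ringKrullDim (Localization.AtPrime P) := by
    refine le_trans ?_ (ringKrullDim_quotient_succ_le_of_nonZeroDivisor hgreg)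
    have : Nontrivial (Localization.AtPrime P ⧸ Ideal.span {g}) :=
      Ideal.Quotient.nontrivial_iff.mpr fun h => by
        rw [Ideal.span_singleton_eq_top] at h
        exact hgmem h
    calc (1 : WithBot ℕ∞) = 0 + 1 := by simp
      _ ≤ _ := by gcongr; exact ringKrullDim_nonneg_of_nontrivial
  refine ⟨[g], hmem, ?_, ?_⟩
  · refine RingTheory.Sequence.IsRegular.of_isWeaklyRegular_of_mem_maximalIdeal _ hmem ?_
    rw [RingTheory.Sequence.isWeaklyRegular_singleton_iff]
    exact (isRegular_iff_mem_nonZeroDivisors.mpr hgreg).left.isSMulRegular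
  · simpa using le_antisymm hge hle

/-- Bridges the `Module.compHom` structure of the main statement and the `Algebra` form above. -/
theorem RingHom.isCohenMacaulay_of_finite_of_free {A G : Type*} [CommRing A] [IsDomain A]
    [IsPrincipalIdealRing A] (hA : ¬ IsField A) [CommRing G] (f : A →+* G)
    (finite : letI := Module.compHom G f; Module.Finite A G)
    (free : letI := Module.compHom G f; Module.Free A G) : IsCohenMacaulay G := by
  let : Algebra A G := f.toAlgebra
  have : Module.Finite A G := finite
  have : Module.Free A G := free
  exact isCohenMacaulay_of_finite_of_isTorsionFree A G hA

/-! ### Base `n+1` digits and the structure of the semigroup. -/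

theorem digits_unique {n a b a' b' : ℕ} (ha : a ≤ n) (ha' : a' ≤ n)
    (h : a + (n + 1) * b = a' + (n + 1) * b') : a = a' ∧ b = b' := by
  have h1 := congrArg (· % (n + 1)) h
  have h2 := congrArg (· / (n + 1)) h
  simpa [Nat.add_mul_mod_self_left, Nat.add_mul_div_left, Nat.mod_eq_of_lt, Nat.div_eq_of_lt,
    Nat.lt_succ_of_le ha, Nat.lt_succ_of_le ha'] using And.intro h1 h2

theorem exists_digits {n i : ℕ} (hi : i < n ^ 2 + 2 * n) :
    ∃ a b, a ≤ n ∧ b ≤ n ∧ i = a + (n + 1) * b :=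
  ⟨i % (n + 1), i / (n + 1), Nat.lt_succ_iff.mp (Nat.mod_lt _ n.succ_pos),
    Nat.lt_succ_iff.mp (Nat.div_lt_of_lt_mul (by nlinarith)), (Nat.mod_add_div i (n + 1)).symm⟩

theorem digits_lt {n q a b : ℕ} (hq : q < n) (ha : a ≤ q) (hb : b ≤ q) :
    a + (n + 1) * b < n ^ 2 + 2 * n := by
  nlinarith [Nat.mul_le_mul_left (n + 1) hb]

namespace unboundedSemigroup

/-- The generators of `unboundedSemigroup n`. -/
def generators (n : ℕ) : Finset ℕ :=
  {n ^ 2 + 2 * n, n ^ 2 + 2 * n + 1, n ^ 2 + 3 * n + 1, n ^ 2 + 3 * n + 2}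

theorem generators_mem {n g : ℕ} (hg : g ∈ generators n) : g ∈ unboundedSemigroup n :=
  AddSubmonoid.subset_closure (by simpa [generators] using hg)

theorem le_of_mem_generators {n g : ℕ} (hg : g ∈ generators n) : n ^ 2 + 2 * n ≤ g := by
  simp only [generators, Finset.mem_insert, Finset.mem_singleton] at hg
  omega

theorem digit_mem_generators {n e e' : ℕ} (he : e ≤ 1) (he' : e' ≤ 1) :
    n ^ 2 + 2 * n + (e + (n + 1) * e') ∈ generators n := by
  interval_cases e <;> interval_cases e' <;> simp [generators] <;> omega

theorem of_digits {n q a b : ℕ} (ha : a ≤ q) (hb : b ≤ q) :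
    q * (n ^ 2 + 2 * n) + (a + (n + 1) * b) ∈ unboundedSemigroup n := by
  induction q generalizing a b with
  | zero => simp [Nat.le_zero.mp ha, Nat.le_zero.mp hb]
  | succ q ih =>
    -- Truncated subtraction: `e` is `1` if `a > 0` and `0` otherwise, so one generator absorbs one
    -- unit of each nonzero digit.
    obtain ⟨a', e, rfl, ha', he⟩ : ∃ a' e, a = a' + e ∧ a' ≤ q ∧ e ≤ 1 :=
      ⟨a - 1, a - (a - 1), by omega, by omega, by omega⟩
    obtain ⟨b', e', rfl, hb', he'⟩ : ∃ b' e, b = b' + e ∧ b' ≤ q ∧ e ≤ 1 :=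
      ⟨b - 1, b - (b - 1), by omega, by omega, by omega⟩
    convert add_mem (ih ha' hb') (generators_mem (digit_mem_generators (n := n) he he')) using 1
    ring

/-- The elements of the semigroup between `q (n² + 2n)` and `(q + 1) (n² + 2n)` have the form
`q (n² + 2n) + a + (n + 1) b` with `a, b ≤ q`. -/
theorem exists_digits_of_mem {n s : ℕ} (hn : 0 < n) (hs : s ∈ unboundedSemigroup n) :
    ∃ a b, a ≤ s / (n ^ 2 + 2 * n) ∧ b ≤ s / (n ^ 2 + 2 * n) ∧
      s % (n ^ 2 + 2 * n) = a + (n + 1) * b := by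
  have hm : 0 < n ^ 2 + 2 * n := by positivity
  obtain ⟨q, a, b, ha, hb, rfl⟩ : ∃ q a b, a ≤ q ∧ b ≤ q ∧
      s = q * (n ^ 2 + 2 * n) + (a + (n + 1) * b) := by
    refine AddSubmonoid.closure_induction ?_ ?_ ?_ hs
    · rintro x (rfl | rfl | rfl | rfl)
      · exact ⟨1, 0, 0, by simp⟩
      · exact ⟨1, 1, 0, by simp⟩
      · exact ⟨1, 0, 1, by simp, by simp, by ring⟩
      · exact ⟨1, 1, 1, by simp, by simp, by ring⟩
    · exact ⟨0, 0, 0, by simp⟩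
    · rintro x y _ _ ⟨q, a, b, ha, hb, rfl⟩ ⟨q', a', b', ha', hb', rfl⟩
      exact ⟨q + q', a + a', b + b', by omega, by omega, by ring⟩
  rcases lt_or_ge q n with hq | hq
  · have hlt := digits_lt hq ha hb
    rw [mul_comm q, Nat.mul_add_div hm, Nat.mul_add_mod, Nat.div_eq_of_lt hlt,
      Nat.mod_eq_of_lt hlt]
    exact ⟨a, b, ha, hb, rfl⟩
  -- For `q ≥ n` the digit part may carry past `n² + 2n`, but then the bound is vacuous: every
  -- residue has digits at most `n ≤ q ≤ s / (n² + 2n)`.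
  · set s := q * (n ^ 2 + 2 * n) + (a + (n + 1) * b)
    have hqs : q ≤ s / (n ^ 2 + 2 * n) := (Nat.le_div_iff_mul_le hm).mpr (Nat.le_add_right _ _)
    obtain ⟨a', b', ha', hb', h⟩ := exists_digits (Nat.mod_lt s hm)
    exact ⟨a', b', by omega, by omega, h⟩

/-- Lowering each nonzero digit by one together with the quotient keeps the digits bounded by the
quotient. This is the combinatorial reason why order of vanishing determines the powers of `𝔪`. -/
theorem exists_generator_sub {n d s : ℕ} (hn : 0 < n) (hs : s ∈ unboundedSemigroup n)
    (hd : (d + 1) * (n ^ 2 + 2 * n) ≤ s) :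
    ∃ g ∈ generators n, g ≤ s ∧ s - g ∈ unboundedSemigroup n ∧ d * (n ^ 2 + 2 * n) ≤ s - g := by
  have hm : 0 < n ^ 2 + 2 * n := by positivity
  obtain ⟨a, b, ha, hb, h⟩ := exists_digits_of_mem hn hs
  have hq := (Nat.le_div_iff_mul_le hm).mpr hd
  have hs' := Nat.div_add_mod s (n ^ 2 + 2 * n)
  obtain ⟨q, hq'⟩ : ∃ q, s / (n ^ 2 + 2 * n) = q + 1 := ⟨_, (Nat.sub_add_cancel (by omega)).symm⟩
  rw [hq'] at ha hb hq hs'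
  obtain ⟨a', e, rfl, ha', he⟩ : ∃ a' e, a = a' + e ∧ a' ≤ q ∧ e ≤ 1 :=
    ⟨a - 1, a - (a - 1), by omega, by omega, by omega⟩
  obtain ⟨b', e', rfl, hb', he'⟩ : ∃ b' e, b = b' + e ∧ b' ≤ q ∧ e ≤ 1 :=
    ⟨b - 1, b - (b - 1), by omega, by omega, by omega⟩
  have hsum : s = (n ^ 2 + 2 * n + (e + (n + 1) * e')) +
      (q * (n ^ 2 + 2 * n) + (a' + (n + 1) * b')) := by
    rw [← hs', h]; ring
  refine ⟨_, digit_mem_generators he he', hsum ▸ Nat.le_add_right _ _, ?_, ?_⟩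
  · rw [hsum, Nat.add_sub_cancel_left]
    exact of_digits ha' hb'
  · rw [hsum, Nat.add_sub_cancel_left]
    exact le_add_right (Nat.mul_le_mul_right _ (by omega))

theorem le_of_mem {n s : ℕ} (hn : 0 < n) (hs : s ∈ unboundedSemigroup n) (h0 : s ≠ 0) :
    n ^ 2 + 2 * n ≤ s := by
  by_contra! h
  obtain ⟨a, b, ha, hb, h'⟩ := exists_digits_of_mem hn hs
  rw [Nat.div_eq_of_lt h] at ha hb
  rw [Nat.mod_eq_of_lt h, Nat.le_zero.mp ha, Nat.le_zero.mp hb] at h'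
  exact h0 h'

end unboundedSemigroup

/-! ### Generators of the free module and residues modulo `n² + 2n`. -/

namespace unboundedIndex

/-- The residue modulo `n² + 2n` of the exponent of the generator with index `j`. -/
def residue {n : ℕ} (j : unboundedIndex n) : ℕ :=
  if (j.2 : ℕ) < j.1 then j.1 + (n + 1) * j.2 else (j.2 - j.1) + (n + 1) * j.1

/-- The index `(j, l)` runs through the digit pairs of maximum `j`: `(j, l)` for `l < j`, then `(l -
j, j)`. When `j = n` the range `l < 2n` stops just before `(n, n)`. -/
theorem residue_eq {n : ℕ} (j : unboundedIndex n) : ∃ a b, residue j = a + (n + 1) * b ∧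
    a ≤ (j.1 : ℕ) ∧ b ≤ (j.1 : ℕ) ∧ (a ≠ n ∨ b ≠ n) ∧
    ((a = j.1 ∧ b = j.2 ∧ b < a) ∨ (a + b = j.2 ∧ b = j.1)) := by
  obtain ⟨⟨j, hj⟩, ⟨l, hl⟩⟩ := j
  simp only at hl
  by_cases h : l < j
  · exact ⟨j, l, by simp [residue, h], by simp, by simp; omega, by omega, Or.inl ⟨rfl, rfl, h⟩⟩
  · refine ⟨l - j, j, by simp [residue, h], ?_, by simp, ?_, Or.inr ⟨?_, rfl⟩⟩
    · simp only; split_ifs at hl <;> omega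
    · split_ifs at hl <;> omega
    · simp only; omega

theorem residue_lt {n : ℕ} (j : unboundedIndex n) : residue j < n ^ 2 + 2 * n := by
  obtain ⟨a, b, h, ha, hb, hab, -⟩ := residue_eq j
  have hj := Nat.lt_succ_iff.mp j.1.2
  rw [h]
  rcases (hb.trans hj).lt_or_eq with hb' | rfl
  · nlinarith [ha.trans hj]
  · have : a < b := by omega
    nlinarith

theorem residue_injective {n : ℕ} : Function.Injective (residue (n := n)) := by
  intro j j' hjj'
  obtain ⟨a, b, h, ha, hb, -, hab⟩ := residue_eq j
  obtain ⟨a', b', h', ha', hb', -, hab'⟩ := residue_eq j'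
  rw [h, h'] at hjj'
  obtain ⟨rfl, rfl⟩ := digits_unique (ha.trans (Nat.lt_succ_iff.mp j.1.2))
    (ha'.trans (Nat.lt_succ_iff.mp j'.1.2)) hjj'
  obtain ⟨⟨j, hj⟩, ⟨l, hl⟩⟩ := j
  obtain ⟨⟨j', hj'⟩, ⟨l', hl'⟩⟩ := j'
  simp only at *
  obtain rfl : j = j' := by omega
  obtain rfl : l = l' := by omega
  rfl

theorem add_residue_mem {n d : ℕ} (j : unboundedIndex n) (hd : (j.1 : ℕ) ≤ d) :
    d * (n ^ 2 + 2 * n) + residue j ∈ unboundedSemigroup n := by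
  obtain ⟨a, b, h, ha, hb, -, -⟩ := residue_eq j
  rw [h]
  exact unboundedSemigroup.of_digits (ha.trans hd) (hb.trans hd)

theorem exists_residue_eq {n d i : ℕ} (hi : i < n ^ 2 + 2 * n)
    (h : d * (n ^ 2 + 2 * n) + i ∈ unboundedSemigroup n) :
    ∃ j : unboundedIndex n, residue j = i ∧ (j.1 : ℕ) ≤ d := by
  have hn : 0 < n := Nat.pos_of_ne_zero fun h => by simp [h] at hi
  -- Membership bounds the digits by `d`, the base `n+1` expansion bounds them by `n`; the smaller
  -- of the two bounds is the one to use.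
  obtain ⟨a, b, ha, hb, hab⟩ : ∃ a b, a ≤ min d n ∧ b ≤ min d n ∧ i = a + (n + 1) * b := by
    obtain ⟨a', b', ha', hb', h'⟩ := exists_digits hi
    obtain ⟨a, b, ha, hb, hab⟩ := unboundedSemigroup.exists_digits_of_mem hn h
    rw [mul_comm d, Nat.mul_add_div (by omega), Nat.div_eq_of_lt hi] at ha hb
    rw [mul_comm d, Nat.mul_add_mod, Nat.mod_eq_of_lt hi] at hab
    rcases le_total d n with hd | hd
    · exact ⟨a, b, by omega, by omega, hab⟩
    · exact ⟨a', b', by omega, by omega, h'⟩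
  have hne : a ≠ n ∨ b ≠ n := by
    by_contra! hc
    obtain ⟨rfl, rfl⟩ := hc
    nlinarith
  -- Inverts `residue`: the degree is `max a b`, and the second entry is `b` or `a + b` according to
  -- which digit is larger.
  by_cases hlt : b < a
  · refine ⟨⟨⟨a, by omega⟩, ⟨b, by simp only; split_ifs <;> omega⟩⟩, ?_, by simp only; omega⟩
    simp [residue, hlt, hab]
  · refine ⟨⟨⟨b, by omega⟩, ⟨a + b, by simp only; split_ifs <;> omega⟩⟩, ?_, by simp only; omega⟩
    simp [residue, hab]

end unboundedIndex

/-! ### Homogeneous elements of blow-up rings. -/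

namespace FiberCone

variable {R : Type*} [CommRing R] {J I I' : Ideal R}

theorem ofDegree_mul_ofDegree {d e : ℕ} (x : ↥(I ^ d)) (y : ↥(I ^ e)) :
    ofDegree J I d x * ofDegree J I e y =
      ofDegree J I (d + e) ⟨x * y, pow_add I d e ▸ Ideal.mul_mem_mul x.2 y.2⟩ := by
  refine congrArg (Ideal.Quotient.mk _) (Subtype.ext ?_)
  exact Polynomial.monomial_mul_monomial d e (x : R) y

theorem map_ofDegree (h : I ≤ I') {d : ℕ} (x : ↥(I ^ d)) :
    map J h (ofDegree J I d x) = ofDegree J I' d ⟨x, Ideal.pow_right_mono h d x.2⟩ :=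
  rfl

theorem algebraMap_eq_ofDegree {k : Type*} [CommRing k] [Algebra k R] (a : k) :
    algebraMap k (FiberCone J I) a = ofDegree J I 0 ⟨algebraMap k R a, by simp⟩ :=
  rfl

theorem eq_ofDegree_of_sub_mem {d : ℕ} {x y : ↥(I ^ d)} (h : (x - y : R) ∈ J * I ^ d) :
    ofDegree J I d x = ofDegree J I d y := by
  rw [← sub_eq_zero, ← map_sub, ofDegree_eq_zero_iff]
  exact h

theorem induction {p : FiberCone J I → Prop} (ofDegree : ∀ d x, p (ofDegree J I d x))
    (zero : p 0) (add : ∀ x y, p x → p y → p (x + y)) (x : FiberCone J I) : p x := by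
  obtain ⟨f, rfl⟩ := Ideal.Quotient.mk_surjective x
  have hsum : f = ∑ i ∈ (f : R[X]).support,
      (⟨Polynomial.monomial i ((f : R[X]).coeff i),
        reesAlgebra.monomial_mem.2 (f.2 i)⟩ : reesAlgebra I) := by
    ext1
    rw [AddSubmonoidClass.coe_finsetSum]
    exact (f : R[X]).as_sum_support
  rw [hsum, map_sum]
  exact Finset.sum_induction _ p add zero fun i _ => ofDegree i ⟨_, f.2 i⟩

end FiberCone

/-! ### Powers of the maximal ideal. -/

namespace unboundedRing

variable {k : Type*} [Field k] {n : ℕ}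

theorem mem_maximalIdeal_iff (f : unboundedRing k n) :
    f ∈ IsLocalRing.maximalIdeal (unboundedRing k n) ↔
      PowerSeries.constantCoeff (f : k⟦X⟧) = 0 := by
  rw [IsLocalRing.mem_maximalIdeal, mem_nonunits_iff, semigroupRing.isUnit_iff, not_not]

theorem coeff_eq_zero (f : unboundedRing k n) {i : ℕ} (hi : i ∉ unboundedSemigroup n) :
    PowerSeries.coeff i (f : k⟦X⟧) = 0 :=
  of_not_not fun h => hi (f.2 i h)

/-- The powers of the maximal ideal are given by the order of vanishing. -/
theorem mem_maximalIdeal_pow_iff (hn : 0 < n) {d : ℕ} (f : unboundedRing k n) :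
    f ∈ IsLocalRing.maximalIdeal (unboundedRing k n) ^ d ↔
      ∀ i < d * (n ^ 2 + 2 * n), PowerSeries.coeff i (f : k⟦X⟧) = 0 := by
  rw [← PowerSeries.X_pow_dvd_iff]
  constructor
  · intro hf
    induction d generalizing f with
    | zero => simp
    | succ d ih =>
      rw [pow_succ] at hf
      refine Submodule.mul_induction_on hf (fun x hx y hy => ?_) fun x y hx hy => dvd_add hx hy
      rw [add_mul, one_mul, pow_add]
      refine mul_dvd_mul (ih x hx) (PowerSeries.X_pow_dvd_iff.mpr fun i hi => ?_)
      rw [mem_maximalIdeal_iff] at hy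
      rcases eq_or_ne i 0 with rfl | h0
      · simpa using hy
      · exact coeff_eq_zero y fun h => (unboundedSemigroup.le_of_mem hn h h0).not_gt hi
  · intro hf
    induction d generalizing f with
    | zero => simp
    | succ d ih =>
      rw [PowerSeries.X_pow_dvd_iff] at hf
      -- `f` may have infinitely many terms, so its exponents are sorted by the generator `γ s` to
      -- be peeled off; this writes `f` as a finite sum of `t^g * f_g` with each `f_g` in `𝔪^d`. Off
      -- the support of `f` the choice of generator is arbitrary.
      have key : ∀ s, ∃ g ∈ unboundedSemigroup.generators n,
          PowerSeries.coeff s (f : k⟦X⟧) ≠ 0 → g ≤ s ∧ s - g ∈ unboundedSemigroup n ∧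
            d * (n ^ 2 + 2 * n) ≤ s - g := by
        intro s
        by_cases hs : PowerSeries.coeff s (f : k⟦X⟧) = 0
        · exact ⟨n ^ 2 + 2 * n, by simp [unboundedSemigroup.generators], fun h => (h hs).elim⟩
        · obtain ⟨g, hg, h⟩ := unboundedSemigroup.exists_generator_sub hn (f.2 s hs)
            (not_lt.mp fun h => hs (hf s h))
          exact ⟨g, hg, fun _ => h⟩
      choose γ hγ hγ' using key
      have hmem : ∀ g, PowerSeries.mk (fun i => if γ (i + g) = g
          then PowerSeries.coeff (i + g) (f : k⟦X⟧) else 0) ∈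
            semigroupRing k (unboundedSemigroup n) := by
        intro g i hi
        rw [PowerSeries.coeff_mk] at hi
        split_ifs at hi with h
        · simpa [h] using (hγ' _ hi).2.1
        · exact absurd rfl hi
      have hpow : ∀ g, (⟨_, hmem g⟩ : unboundedRing k n) ∈
          IsLocalRing.maximalIdeal (unboundedRing k n) ^ d := by
        refine fun g => ih _ (PowerSeries.X_pow_dvd_iff.mpr fun i hi => ?_)
        rw [PowerSeries.coeff_mk]
        split_ifs with h
        · by_contra hne
          have := (hγ' _ hne).2.2
          rw [h, Nat.add_sub_cancel] at this
          exact this.not_gt hi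
        · rfl
      have hsum : f = ∑ g : unboundedSemigroup.generators n,
          semigroupRing.monomial k ⟨g, unboundedSemigroup.generators_mem g.2⟩ *
            (⟨_, hmem g⟩ : unboundedRing k n) := by
        ext s
        rw [AddSubmonoidClass.coe_finsetSum, map_sum,
          Finset.sum_eq_single (⟨γ s, hγ s⟩ : unboundedSemigroup.generators n)]
        · simp only [MulMemClass.coe_mul, semigroupRing.monomial, PowerSeries.coeff_X_pow_mul',
            PowerSeries.coeff_mk]
          by_cases hs : PowerSeries.coeff s (f : k⟦X⟧) = 0
          · split_ifs with h h'
            · rw [Nat.sub_add_cancel h]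
            · exact hs
            · exact hs
          · have := (hγ' s hs).1
            rw [if_pos this, Nat.sub_add_cancel this, if_pos rfl]
        · intro g _ hg
          simp only [MulMemClass.coe_mul, semigroupRing.monomial, PowerSeries.coeff_X_pow_mul',
            PowerSeries.coeff_mk]
          split_ifs with h h'
          · rw [Nat.sub_add_cancel h] at h'
            exact absurd (Subtype.ext h'.symm) hg
          · rfl
          · rfl
        · simp
      rw [hsum, pow_succ']
      refine Ideal.sum_mem _ fun g _ => Ideal.mul_mem_mul ?_ (hpow g)
      have := unboundedSemigroup.le_of_mem_generators g.2
      have hg0 : (g : ℕ) ≠ 0 := by nlinarith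
      rw [mem_maximalIdeal_iff]
      simp [semigroupRing.monomial, hg0]

theorem monomial_mem_maximalIdeal_pow (hn : 0 < n) {d : ℕ} (s : unboundedSemigroup n)
    (hs : d * (n ^ 2 + 2 * n) ≤ s) :
    semigroupRing.monomial k s ∈ IsLocalRing.maximalIdeal (unboundedRing k n) ^ d := by
  rw [mem_maximalIdeal_pow_iff hn]
  intro i hi
  simp [semigroupRing.monomial, PowerSeries.coeff_X_pow, (hi.trans_le hs).ne]

end unboundedRing

/-! ### Coordinates on the tangent cone and its Hilbert series. -/

namespace unboundedTangentCone

variable {k : Type*} [Field k] {n : ℕ}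

/-- For `n = 0` there are no indices, so `coeff` and `monomial` need no positivity argument. -/
theorem pos_of_index (j : unboundedIndex n) : 0 < n :=
  Nat.pos_of_ne_zero fun h => by
    subst h
    exact absurd (unboundedIndex.residue_lt j) (Nat.not_lt_zero _)

/-- In degree `d` the ideal consists of elements of `𝔪^(d+1)`, whose order is at least `(d+1)(n² +
2n)`. This makes `coeff` well defined on the quotient. -/
theorem coeff_rep_eq_zero (hn : 0 < n)
    {f : reesAlgebra (IsLocalRing.maximalIdeal (unboundedRing k n))}
    (hf : f ∈ (IsLocalRing.maximalIdeal (unboundedRing k n)).map (algebraMap _ (reesAlgebra _)))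
    {d i : ℕ} (hi : i < n ^ 2 + 2 * n) :
    PowerSeries.coeff (d * (n ^ 2 + 2 * n) + i)
      ((f : (unboundedRing k n)[X]).coeff d : k⟦X⟧) = 0 := by
  have := (FiberCone.mem_map_iff _ _ f).mp hf d
  rw [← pow_succ', unboundedRing.mem_maximalIdeal_pow_iff hn] at this
  exact this _ (by linarith)

/-- The coefficient of the class of `t ^ (d (n² + 2n) + residue j)` in degree `d` of the tangent
cone. -/
noncomputable def coeff (k : Type*) [Field k] {n : ℕ} (d : ℕ) (j : unboundedIndex n) :
    TangentCone (unboundedRing k n) →+ k :=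
  QuotientAddGroup.lift (Submodule.toAddSubgroup _)
    (AddMonoidHom.mk' (fun f => PowerSeries.coeff (d * (n ^ 2 + 2 * n) + j.residue)
        ((f : (unboundedRing k n)[X]).coeff d : k⟦X⟧)) fun f g => by simp)
    fun _ hf => coeff_rep_eq_zero (pos_of_index j) hf j.residue_lt

theorem coeff_mk (d : ℕ) (j : unboundedIndex n)
    (f : reesAlgebra (IsLocalRing.maximalIdeal (unboundedRing k n))) :
    coeff k d j (Ideal.Quotient.mk _ f) =
      PowerSeries.coeff (d * (n ^ 2 + 2 * n) + j.residue)
        ((f : (unboundedRing k n)[X]).coeff d : k⟦X⟧) :=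
  rfl

theorem coeff_ofDegree (d e : ℕ) (j : unboundedIndex n)
    (x : ↥(IsLocalRing.maximalIdeal (unboundedRing k n) ^ e)) :
    coeff k d j (FiberCone.ofDegree (IsLocalRing.maximalIdeal (unboundedRing k n))
      (IsLocalRing.maximalIdeal (unboundedRing k n)) e x) =
      if e = d then PowerSeries.coeff (d * (n ^ 2 + 2 * n) + j.residue)
        ((x : unboundedRing k n) : k⟦X⟧) else 0 := by
  refine (coeff_mk d j _).trans ?_
  change PowerSeries.coeff _ (((Polynomial.monomial e (x : unboundedRing k n)).coeff d :
    unboundedRing k n) : k⟦X⟧) = _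
  rw [Polynomial.coeff_monomial]
  split_ifs <;> simp

theorem coeff_smul (d : ℕ) (j : unboundedIndex n) (a : k) (g : TangentCone (unboundedRing k n)) :
    coeff k d j (a • g) = a * coeff k d j g := by
  obtain ⟨f, rfl⟩ := Ideal.Quotient.mk_surjective g
  rw [coeff_mk]
  change PowerSeries.coeff _ (((a • (f : (unboundedRing k n)[X])).coeff d :
    unboundedRing k n) : k⟦X⟧) = _
  rw [Polynomial.coeff_smul]
  simp

/-- Modulo `𝔪^(d+1)`, an element of `𝔪^d` is determined by its coefficients at exponents in `[d(n² +
2n), (d+1)(n² + 2n))`, and those lying in the semigroup have the residue of some index. -/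
theorem ext (hn : 0 < n) {g g' : TangentCone (unboundedRing k n)}
    (h : ∀ d (j : unboundedIndex n), coeff k d j g = coeff k d j g') : g = g' := by
  rw [← sub_eq_zero]
  replace h : ∀ d (j : unboundedIndex n), coeff k d j (g - g') = 0 := fun d j => by rw [map_sub, h, sub_self]
  obtain ⟨f, hf⟩ := Ideal.Quotient.mk_surjective (g - g')
  rw [← hf] at h ⊢
  rw [Ideal.Quotient.eq_zero_iff_mem, FiberCone.mem_map_iff]
  intro d
  rw [← pow_succ', unboundedRing.mem_maximalIdeal_pow_iff hn]
  intro i hi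
  rcases lt_or_ge i (d * (n ^ 2 + 2 * n)) with hlt | hge
  · exact (unboundedRing.mem_maximalIdeal_pow_iff hn _).mp (f.2 d) i hlt
  · obtain ⟨i, rfl⟩ := Nat.exists_eq_add_of_le hge
    by_contra hne
    obtain ⟨j, rfl, -⟩ := unboundedIndex.exists_residue_eq (by linarith)
      (((f : (unboundedRing k n)[X]).coeff d).2 _ hne)
    exact hne (h d j)

theorem coeff_eq_zero_of_lt {d : ℕ} {j : unboundedIndex n} (hd : d < (j.1 : ℕ))
    (g : TangentCone (unboundedRing k n)) : coeff k d j g = 0 := by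
  obtain ⟨f, rfl⟩ := Ideal.Quotient.mk_surjective g
  by_contra hne
  obtain ⟨j', hj', h⟩ := unboundedIndex.exists_residue_eq j.residue_lt
    (((f : (unboundedRing k n)[X]).coeff d).2 _ hne)
  rw [unboundedIndex.residue_injective hj'] at h
  omega

theorem exists_coeff_eq_zero (g : TangentCone (unboundedRing k n)) :
    ∃ N, ∀ d, N ≤ d → ∀ j : unboundedIndex n, coeff k d j g = 0 := by
  obtain ⟨f, rfl⟩ := Ideal.Quotient.mk_surjective g
  refine ⟨(f : (unboundedRing k n)[X]).natDegree + 1, fun d hd j => ?_⟩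
  rw [coeff_mk, Polynomial.coeff_eq_zero_of_natDegree_lt hd]
  simp

theorem mem_component_iff (hn : 0 < n) {d : ℕ} {g : TangentCone (unboundedRing k n)} :
    g ∈ TangentCone.component (unboundedRing k n) d ↔ ∀ e (j : unboundedIndex n), e ≠ d → coeff k e j g = 0 := by
  constructor
  · rintro ⟨x, rfl⟩ e j he
    rw [coeff_ofDegree, if_neg he.symm]
  · intro h
    obtain ⟨f, rfl⟩ := Ideal.Quotient.mk_surjective g
    refine ⟨⟨_, f.2 d⟩, unboundedTangentCone.ext hn fun e j => ?_⟩
    rw [coeff_ofDegree]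
    split_ifs with he
    · subst he; rfl
    · exact (h e j (Ne.symm he)).symm

/-- The class of `t ^ (d (n² + 2n) + residue j)` in degree `d` of the tangent cone. -/
noncomputable def monomial (k : Type*) [Field k] {n d : ℕ} (j : unboundedIndex n)
    (hd : (j.1 : ℕ) ≤ d) : TangentCone (unboundedRing k n) :=
  FiberCone.ofDegree (IsLocalRing.maximalIdeal (unboundedRing k n))
    (IsLocalRing.maximalIdeal (unboundedRing k n)) d ⟨semigroupRing.monomial k ⟨_, j.add_residue_mem hd⟩,
    unboundedRing.monomial_mem_maximalIdeal_pow (pos_of_index j) _ (Nat.le_add_right _ _)⟩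

theorem coeff_monomial {d e : ℕ} {j j' : unboundedIndex n} (hd : (j.1 : ℕ) ≤ d) :
    coeff k e j' (monomial k j hd) = if d = e ∧ j = j' then 1 else 0 := by
  rw [monomial, coeff_ofDegree, ite_and]
  by_cases hde : d = e
  · subst hde
    simp [semigroupRing.monomial, PowerSeries.coeff_X_pow,
      unboundedIndex.residue_injective.eq_iff, eq_comm]
  · simp [hde]

theorem monomial_mem_component {d : ℕ} {j : unboundedIndex n} (hd : (j.1 : ℕ) ≤ d) :
    monomial k j hd ∈ TangentCone.component (unboundedRing k n) d :=
  ⟨_, rfl⟩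

end unboundedTangentCone

/-- The `c i` are coordinates dual to the `b i` and separate points, so together they identify the
component with `ι → k`. -/
theorem TangentCone.finrank_component {k R ι : Type*} [Field k] [CommRing R] [IsLocalRing R]
    [Algebra k R] [Fintype ι] [DecidableEq ι] {d : ℕ} (c : ι → TangentCone R →+ k)
    (c_smul : ∀ i (a : k) g, c i (a • g) = a * c i g) (b : ι → TangentCone R)
    (b_mem : ∀ i, b i ∈ TangentCone.component R d)
    (c_b : ∀ i j, c i (b j) = if j = i then 1 else 0)
    (c_inj : ∀ g ∈ TangentCone.component R d, (∀ i, c i g = 0) → g = 0) :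
    Module.Finite k (TangentCone.component R d) ∧
      Module.finrank k (TangentCone.component R d) = Fintype.card ι := by
  let L : TangentCone.component R d →ₗ[k] (ι → k) :=
    { toFun := fun g i => c i g
      map_add' := fun x y => funext fun i => map_add (c i) (x : TangentCone R) y
      map_smul' := fun a x => funext fun i => c_smul i a x }
  have hL : Function.Bijective L := by
    refine ⟨(injective_iff_map_eq_zero L).mpr fun g hg =>
      Subtype.ext (c_inj g g.2 fun i => congrFun hg i), fun w => ?_⟩
    refine ⟨∑ i, w i • ⟨b i, b_mem i⟩, funext fun i => ?_⟩
    rw [map_sum, Finset.sum_apply, Finset.sum_eq_single i]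
    · rw [map_smul, Pi.smul_apply]
      change w i * c i (b i) = _
      rw [c_b, if_pos rfl, mul_one]
    · intro j _ hj
      rw [map_smul, Pi.smul_apply]
      change w j * c i (b j) = _
      rw [c_b, if_neg hj, mul_zero]
    · simp
  let e := LinearEquiv.ofBijective L hL
  exact ⟨Module.Finite.equiv e.symm, by rw [e.finrank_eq, Module.finrank_fintype_fun_eq_card]⟩

namespace unboundedTangentCone

variable {k : Type*} [Field k] {n : ℕ}

theorem finrank_component (k : Type*) [Field k] (hn : 0 < n) (d : ℕ) :
    Module.Finite k (TangentCone.component (unboundedRing k n) d) ∧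
      Module.finrank k (TangentCone.component (unboundedRing k n) d) =
        Fintype.card {j : unboundedIndex n // (j.1 : ℕ) ≤ d} := by
  refine TangentCone.finrank_component (fun j => coeff k d j.1) (fun j => coeff_smul d j.1)
    (fun j => monomial k j.1 j.2) (fun j => monomial_mem_component j.2) (fun i j => ?_) ?_
  · simp [coeff_monomial, Subtype.ext_iff]
  · intro g hg h
    refine unboundedTangentCone.ext hn fun e j => ?_
    rw [map_zero]
    by_cases he : e = d
    · subst he
      by_cases hj : (j.1 : ℕ) ≤ e
      · exact h ⟨j, hj⟩
      · exact coeff_eq_zero_of_lt (not_le.mp hj) g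
    · exact (mem_component_iff hn).mp hg e j he

/-- Each index contributes `1` in every degree from its own onwards, that is `x^j / (1 - x)`. -/
theorem hilbertSeries_eq (hn : 0 < n) :
    TangentCone.hilbertSeries k (unboundedRing k n) =
      ((∑ j ∈ Finset.range n, PowerSeries.C (2 * (j : ℚ) + 1) * PowerSeries.X ^ j) +
        PowerSeries.C (2 * (n : ℚ)) * PowerSeries.X ^ n) *
        (1 - PowerSeries.X : PowerSeries ℚ)⁻¹ := by
  have hsum : (∑ j ∈ Finset.range n, PowerSeries.C (2 * (j : ℚ) + 1) * PowerSeries.X ^ j) +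
      PowerSeries.C (2 * (n : ℚ)) * PowerSeries.X ^ n =
        ∑ j : unboundedIndex n, (PowerSeries.X : ℚ⟦X⟧) ^ (j.1 : ℕ) := by
    rw [Fintype.sum_sigma, Fin.sum_univ_castSucc, ← Fin.sum_univ_eq_sum_range fun j =>
      PowerSeries.C (2 * (j : ℚ) + 1) * (PowerSeries.X : ℚ⟦X⟧) ^ j]
    congr 1
    · refine Finset.sum_congr rfl fun j _ => ?_
      simp [map_ofNat]
    · simp [map_ofNat]
  rw [PowerSeries.eq_mul_inv_iff_mul_eq (by simp), hsum]
  have hH : TangentCone.hilbertSeries k (unboundedRing k n) =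
      ∑ j : unboundedIndex n, (PowerSeries.X : ℚ⟦X⟧) ^ (j.1 : ℕ) * PowerSeries.mk 1 := by
    ext d
    rw [TangentCone.hilbertSeries, PowerSeries.coeff_mk, (finrank_component k hn d).2, Fintype.card_subtype, map_sum]
    simp [PowerSeries.coeff_X_pow_mul']
  rw [hH, Finset.sum_mul]
  refine Finset.sum_congr rfl fun j _ => ?_
  rw [mul_assoc, PowerSeries.mk_one_mul_one_sub_eq_one, mul_one]

end unboundedTangentCone

/-! ### The fiber cone as a quotient of `k[T]` and its action on the tangent cone. -/

namespace unboundedFiberCone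

variable {k : Type*} [Field k] {n : ℕ}

theorem monomial_mult_pow_mem (k : Type*) [Field k] (n d : ℕ) :
    semigroupRing.monomial k (unboundedSemigroup.mult n) ^ d ∈ unboundedIdeal k n ^ d :=
  Ideal.pow_mem_pow (Ideal.mem_span_singleton_self _) d

/-- The class of `a t ^ (d (n² + 2n))` in degree `d` of the fiber cone. -/
noncomputable def monomial (n d : ℕ) (a : k) : unboundedFiberCone k n :=
  FiberCone.ofDegree (IsLocalRing.maximalIdeal (unboundedRing k n)) (unboundedIdeal k n) d
    ⟨algebraMap k (unboundedRing k n) a *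
      semigroupRing.monomial k (unboundedSemigroup.mult n) ^ d,
      Ideal.mul_mem_left _ _ (monomial_mult_pow_mem k n d)⟩

theorem algebraMap_mul_pow (d : ℕ) (a : k) :
    algebraMap k (unboundedFiberCone k n) a * (monomial n 1 (1 : k)) ^ d = monomial n d a := by
  induction d with
  | zero =>
    rw [pow_zero, mul_one, FiberCone.algebraMap_eq_ofDegree, monomial]
    congr 2
    simp
  | succ d ih =>
    rw [pow_succ, ← mul_assoc, ih, monomial, monomial, FiberCone.ofDegree_mul_ofDegree, monomial]
    congr 2
    simp [pow_succ, mul_assoc]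

/-- The map `k[T] → F(I)` sending `T` to the class of `t ^ (n² + 2n)` in degree one. -/
noncomputable def ofPolynomial (k : Type*) [Field k] (n : ℕ) : k[X] →+* unboundedFiberCone k n :=
  Polynomial.eval₂RingHom (algebraMap k (unboundedFiberCone k n)) (monomial n 1 1)

theorem ofPolynomial_monomial (d : ℕ) (a : k) :
    ofPolynomial k n (Polynomial.monomial d a) = monomial n d a := by
  rw [ofPolynomial, Polynomial.coe_eval₂RingHom, Polynomial.eval₂_monomial, algebraMap_mul_pow]

/-- Modulo `𝔪 I^d`, the coefficient `u` in `u t^(d(n² + 2n))` can be replaced by its constant term.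
-/
theorem ofDegree_eq_monomial (d : ℕ) (x : ↥(unboundedIdeal k n ^ d)) :
    ∃ a : k, FiberCone.ofDegree (IsLocalRing.maximalIdeal (unboundedRing k n))
      (unboundedIdeal k n) d x = monomial n d a := by
  obtain ⟨x, hx⟩ := x
  have hx' := hx
  rw [unboundedIdeal, Ideal.span_singleton_pow, Ideal.mem_span_singleton'] at hx'
  obtain ⟨u, rfl⟩ := hx'
  refine ⟨PowerSeries.constantCoeff (u : k⟦X⟧), FiberCone.eq_ofDegree_of_sub_mem ?_⟩
  rw [← sub_mul]
  refine Ideal.mul_mem_mul ?_ (monomial_mult_pow_mem k n d)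
  rw [unboundedRing.mem_maximalIdeal_iff]
  change PowerSeries.constantCoeff ((u : k⟦X⟧) - algebraMap k k⟦X⟧ _) = 0
  simp

theorem ofPolynomial_surjective : Function.Surjective (ofPolynomial k n) := by
  intro x
  induction x using FiberCone.induction with
  | ofDegree d x =>
    obtain ⟨a, ha⟩ := ofDegree_eq_monomial d x
    exact ⟨Polynomial.monomial d a, by rw [ofPolynomial_monomial, ha]⟩
  | zero => exact ⟨0, map_zero _⟩
  | add x y hx hy =>
    obtain ⟨p, rfl⟩ := hx
    obtain ⟨q, rfl⟩ := hy
    exact ⟨p + q, map_add _ p q⟩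

theorem ofPolynomial_mem_component {d : ℕ} {p : k[X]} (hp : ∀ e, e ≠ d → p.coeff e = 0) :
    ofPolynomial k n p ∈ FiberCone.component (IsLocalRing.maximalIdeal (unboundedRing k n))
      (unboundedIdeal k n) d := by
  have : p = Polynomial.monomial d (p.coeff d) := by
    ext e
    rw [Polynomial.coeff_monomial]
    split_ifs with h
    · rw [h]
    · exact hp e (Ne.symm h)
  rw [this, ofPolynomial_monomial]
  exact ⟨_, rfl⟩

theorem exists_of_mem_component {d : ℕ} {x : unboundedFiberCone k n}
    (hx : x ∈ FiberCone.component (IsLocalRing.maximalIdeal (unboundedRing k n))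
      (unboundedIdeal k n) d) : ∃ a : k, ofPolynomial k n (Polynomial.monomial d a) = x := by
  obtain ⟨y, rfl⟩ := hx
  obtain ⟨a, ha⟩ := ofDegree_eq_monomial d y
  exact ⟨a, by rw [ofPolynomial_monomial, ha]⟩

/-- `T^e` adds `e(n² + 2n)` to the exponent and `e` to the degree, so distinct residues never
interact. -/
theorem coeff_toTangentCone_mul_monomial (hn : 5 ≤ n) (p : k[X]) (j j' : unboundedIndex n)
    (d : ℕ) :
    unboundedTangentCone.coeff k d j' (toTangentCone k hn (ofPolynomial k n p) *
      unboundedTangentCone.monomial k j le_rfl) =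
      if j = j' ∧ (j.1 : ℕ) ≤ d then p.coeff (d - j.1) else 0 := by
  induction p using Polynomial.induction_on' with
  | add p q hp hq =>
    rw [map_add, RingHom.map_add, add_mul, map_add, hp, hq, Polynomial.coeff_add]
    split_ifs <;> simp
  | monomial e a =>
    rw [ofPolynomial_monomial, monomial, toTangentCone, FiberCone.map_ofDegree,
      unboundedTangentCone.monomial, FiberCone.ofDegree_mul_ofDegree,
      unboundedTangentCone.coeff_ofDegree, Polynomial.coeff_monomial]
    have hval : ((algebraMap k (unboundedRing k n) a *
        semigroupRing.monomial k (unboundedSemigroup.mult n) ^ e *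
        semigroupRing.monomial k ⟨_, j.add_residue_mem le_rfl⟩ : unboundedRing k n) : k⟦X⟧) =
        PowerSeries.monomial ((e + j.1) * (n ^ 2 + 2 * n) + j.residue) a := by
      change algebraMap k k⟦X⟧ a * (PowerSeries.X ^ (n ^ 2 + 2 * n)) ^ e *
        PowerSeries.X ^ (j.1 * (n ^ 2 + 2 * n) + j.residue) = _
      rw [PowerSeries.monomial_eq_C_mul_X_pow, PowerSeries.algebraMap_apply, ← pow_mul, mul_assoc,
        ← pow_add]
      congr 2
      ring
    by_cases hd : e + j.1 = d
    · subst hd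
      simp only [if_true]
      rw [hval, PowerSeries.coeff_monomial]
      by_cases hj : j = j'
      · simp [hj]
      · simp [hj, Ne.symm hj, unboundedIndex.residue_injective.eq_iff]
    · rw [if_neg hd]
      split_ifs with h1 h2
      · omega
      · rfl
      · rfl

end unboundedFiberCone

/-! ### Graded freeness of the tangent cone. -/

namespace unboundedFiberCone

variable {k : Type*} [Field k] {n : ℕ}

theorem ofPolynomial_injective (hn : 5 ≤ n) : Function.Injective (ofPolynomial k n) := by
  refine (injective_iff_map_eq_zero _).mpr fun p hp => Polynomial.ext fun d => ?_
  -- The index of degree `0` and residue `0` stands for the class of `1`, so the coefficients of `p`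
  -- can be read off its image in the tangent cone.
  have := coeff_toTangentCone_mul_monomial hn p
    (⟨⟨0, n.succ_pos⟩, ⟨0, by simp only; split_ifs <;> omega⟩⟩ : unboundedIndex n)
    ⟨⟨0, n.succ_pos⟩, ⟨0, by simp only; split_ifs <;> omega⟩⟩ d
  rw [hp, RingHom.map_zero, zero_mul, map_zero] at this
  simpa using this.symm

/-- The fiber cone is a polynomial ring in one variable over `k`. -/
noncomputable def polynomialEquiv (k : Type*) [Field k] (hn : 5 ≤ n) :
    k[X] ≃+* unboundedFiberCone k n :=
  RingEquiv.ofBijective (ofPolynomial k n) ⟨ofPolynomial_injective hn, ofPolynomial_surjective⟩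

theorem polynomialEquiv_mem_component_iff (hn : 5 ≤ n) {d : ℕ} {p : k[X]} :
    polynomialEquiv k hn p ∈ FiberCone.component (IsLocalRing.maximalIdeal (unboundedRing k n))
      (unboundedIdeal k n) d ↔ ∀ e, e ≠ d → p.coeff e = 0 := by
  refine ⟨fun h e he => ?_, ofPolynomial_mem_component⟩
  obtain ⟨a, ha⟩ := exists_of_mem_component h
  rw [← ofPolynomial_injective hn ha, Polynomial.coeff_monomial, if_neg he.symm]

/-- The tangent cone as a module over the fiber cone. -/
noncomputable abbrev tangentConeModule (k : Type*) [Field k] (hn : 5 ≤ n) :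
    Module (unboundedFiberCone k n) (TangentCone (unboundedRing k n)) :=
  Module.compHom _ (toTangentCone k hn)

/-- The map from the free module sending the basis vector with index `j` to the class of the
monomial of least degree whose exponent has residue `residue j`. -/
noncomputable def freeMap (k : Type*) [Field k] (hn : 5 ≤ n) :
    letI := tangentConeModule k hn
    (unboundedIndex n →₀ unboundedFiberCone k n) →ₗ[unboundedFiberCone k n]
      TangentCone (unboundedRing k n) :=
  letI := tangentConeModule k hn
  Finsupp.linearCombination _ fun j => unboundedTangentCone.monomial k j le_rfl

/-- In coordinates `freeMap` only shifts the degree of the `j`-th entry by `j.1`; its bijectivity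
and its compatibility with the gradings are read off from this. -/
theorem coeff_freeMap (hn : 5 ≤ n) (v : unboundedIndex n →₀ unboundedFiberCone k n) (d : ℕ)
    (j : unboundedIndex n) :
    unboundedTangentCone.coeff k d j (freeMap k hn v) =
      if (j.1 : ℕ) ≤ d then ((polynomialEquiv k hn).symm (v j)).coeff (d - j.1) else 0 := by
  let := tangentConeModule k hn
  have h : freeMap k hn v = ∑ i, toTangentCone k hn
      (ofPolynomial k n ((polynomialEquiv k hn).symm (v i))) *
        unboundedTangentCone.monomial k i le_rfl := by
    rw [freeMap, Finsupp.linearCombination_apply, Finsupp.sum_fintype]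
    swap
    · intro i
      change toTangentCone k hn 0 * _ = 0
      rw [RingHom.map_zero, zero_mul]
    refine Finset.sum_congr rfl fun i _ => ?_
    rw [show ofPolynomial k n ((polynomialEquiv k hn).symm (v i)) = v i from
      (polynomialEquiv k hn).apply_symm_apply (v i)]
    rfl
  rw [h, map_sum, Finset.sum_eq_single j]
  · rw [coeff_toTangentCone_mul_monomial]
    simp
  · intro i _ hi
    rw [coeff_toTangentCone_mul_monomial, if_neg fun h => hi h.1]
  · simp

theorem freeMap_injective (hn : 5 ≤ n) : Function.Injective (freeMap k hn) := by
  let := tangentConeModule k hn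
  refine (injective_iff_map_eq_zero _).mpr fun v hv => Finsupp.ext fun j => ?_
  rw [Finsupp.zero_apply, ← (polynomialEquiv k hn).symm.map_eq_zero_iff]
  ext d
  have := coeff_freeMap hn v (d + j.1) j
  rw [hv, map_zero, if_pos (Nat.le_add_left _ _), Nat.add_sub_cancel] at this
  rw [← this, Polynomial.coeff_zero]

theorem freeMap_surjective (hn : 5 ≤ n) : Function.Surjective (freeMap k hn) := by
  intro g
  obtain ⟨N, hN⟩ := unboundedTangentCone.exists_coeff_eq_zero g
  -- The `j`-th entry collects the coefficients of `g` at residue `j`, shifted down by `j.1`; the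
  -- bound `N` makes it a polynomial.
  let p : unboundedIndex n → k[X] := fun j => ∑ d ∈ Finset.range N,
    Polynomial.monomial d (unboundedTangentCone.coeff k (d + j.1) j g)
  have hp : ∀ j d, (p j).coeff d = unboundedTangentCone.coeff k (d + j.1) j g := by
    intro j d
    rw [Polynomial.finsetSum_coeff]
    simp only [Polynomial.coeff_monomial, Finset.sum_ite_eq', Finset.mem_range]
    split_ifs with h
    · rfl
    · exact (hN _ (by omega) j).symm
  refine ⟨Finsupp.equivFunOnFinite.symm fun j => polynomialEquiv k hn (p j),
    unboundedTangentCone.ext (by omega) fun d j => ?_⟩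
  rw [coeff_freeMap, Finsupp.equivFunOnFinite_symm_apply_apply, RingEquiv.symm_apply_apply, hp]
  split_ifs with h
  · rw [Nat.sub_add_cancel h]
  · exact (unboundedTangentCone.coeff_eq_zero_of_lt (not_le.mp h) g).symm

theorem mem_shiftedComponent_iff (hn : 5 ≤ n) (d : ℕ)
    (v : unboundedIndex n →₀ unboundedFiberCone k n) :
    v ∈ FiberCone.shiftedComponent (IsLocalRing.maximalIdeal (unboundedRing k n))
        (unboundedIdeal k n) (fun j : unboundedIndex n => (j.1 : ℕ)) d ↔
      freeMap k hn v ∈ TangentCone.component (unboundedRing k n) d := by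
  rw [unboundedTangentCone.mem_component_iff (by omega)]
  simp only [coeff_freeMap]
  have hv : ∀ j, v j = polynomialEquiv k hn ((polynomialEquiv k hn).symm (v j)) := fun j =>
    ((polynomialEquiv k hn).apply_symm_apply (v j)).symm
  constructor
  · intro h e j he
    split_ifs with hj
    · rcases le_or_gt (j.1 : ℕ) d with hd | hd
      · have := (h j).1 hd
        rw [hv, polynomialEquiv_mem_component_iff] at this
        exact this _ (by simp only; omega)
      · rw [(h j).2 hd, map_zero, Polynomial.coeff_zero]
    · rfl
  · intro h j
    constructor
    · intro (hd : (j.1 : ℕ) ≤ d)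
      rw [hv, polynomialEquiv_mem_component_iff]
      intro e (he : e ≠ d - j.1)
      simpa using h (e + j.1) j (by omega)
    · intro (hd : d < j.1)
      rw [← (polynomialEquiv k hn).symm.map_eq_zero_iff]
      ext e
      simpa using h (e + j.1) j (by omega)

theorem isCohenMacaulay_tangentCone (k : Type*) [Field k] (hn : 5 ≤ n) :
    IsCohenMacaulay (TangentCone (unboundedRing k n)) := by
  let := tangentConeModule k hn
  have : IsDomain (unboundedFiberCone k n) := (polynomialEquiv k hn).symm.toMulEquiv.isDomain _
  have : IsPrincipalIdealRing (unboundedFiberCone k n) :=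
    IsPrincipalIdealRing.of_surjective (ofPolynomial k n) ofPolynomial_surjective
  have e : (unboundedIndex n →₀ unboundedFiberCone k n) ≃ₗ[unboundedFiberCone k n]
      TangentCone (unboundedRing k n) :=
    LinearEquiv.ofBijective (freeMap k hn) ⟨freeMap_injective hn, freeMap_surjective hn⟩
  have finite : Module.Finite (unboundedFiberCone k n) (TangentCone (unboundedRing k n)) :=
    Module.Finite.equiv e
  have free : Module.Free (unboundedFiberCone k n) (TangentCone (unboundedRing k n)) :=
    Module.Free.of_equiv e
  refine RingHom.isCohenMacaulay_of_finite_of_free (A := unboundedFiberCone k n)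
    (G := TangentCone (unboundedRing k n)) (fun h => ?_) (toTangentCone k hn) finite free
  exact Polynomial.not_isField k ((polynomialEquiv k hn).toMulEquiv.isField h)

end unboundedFiberCone

theorem mainTheorem8 {k : Type*} [Field k] (n : ℕ) (hn : 5 ≤ n) :
    letI : Module (unboundedFiberCone k n) (TangentCone (unboundedRing k n)) :=
      Module.compHom _ (unboundedFiberCone.toTangentCone k hn)
    Module.Free (unboundedFiberCone k n) (TangentCone (unboundedRing k n)) ∧
    (∃ φ : (unboundedIndex n →₀ unboundedFiberCone k n) ≃ₗ[unboundedFiberCone k n]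
        TangentCone (unboundedRing k n),
      ∀ (d : ℕ) (v : unboundedIndex n →₀ unboundedFiberCone k n),
        v ∈ FiberCone.shiftedComponent (IsLocalRing.maximalIdeal (unboundedRing k n))
            (unboundedIdeal k n) (fun j : unboundedIndex n => (j.1 : ℕ)) d ↔
          φ v ∈ TangentCone.component (unboundedRing k n) d) ∧
    IsCohenMacaulay (TangentCone (unboundedRing k n)) ∧
    (∀ d : ℕ, Module.Finite k (TangentCone.component (unboundedRing k n) d)) ∧
    TangentCone.hilbertSeries k (unboundedRing k n) =
      ((∑ j ∈ Finset.range n, PowerSeries.C (2 * (j : ℚ) + 1) * PowerSeries.X ^ j) +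
        PowerSeries.C (2 * (n : ℚ)) * PowerSeries.X ^ n) *
        (1 - PowerSeries.X : PowerSeries ℚ)⁻¹ := by
  have hn0 : 0 < n := by omega
  let := unboundedFiberCone.tangentConeModule k hn
  let φ : (unboundedIndex n →₀ unboundedFiberCone k n) ≃ₗ[unboundedFiberCone k n]
      TangentCone (unboundedRing k n) :=
    LinearEquiv.ofBijective (unboundedFiberCone.freeMap k hn)
      ⟨unboundedFiberCone.freeMap_injective hn, unboundedFiberCone.freeMap_surjective hn⟩
  exact ⟨Module.Free.of_equiv φ, ⟨φ, unboundedFiberCone.mem_shiftedComponent_iff hn⟩,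
    unboundedFiberCone.isCohenMacaulay_tangentCone k hn,
    fun d => (unboundedTangentCone.finrank_component k hn0 d).1,
    unboundedTangentCone.hilbertSeries_eq hn0⟩
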